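/- Let $M\subseteq\mathbb{R}^D$ be a compact connected $d$-dimensional $\mathcal{C}^2$ submanifold without boundary, and let $A\subseteq M$ be a finite set. Let $\tau(M)\in[0,\infty]$ be the reach of $M$, that is, the supremum of all $r$ such that every $x\in\mathbb{R}^D$ with $d(x,M)<r$ has a unique nearest point $\pi_M(x)$ in $M$. Let $\varepsilon(A)=d_H(A,M)$ be the Hausdorff distance between $A$ and $M$ (which is $\sup_{x\in M}d(x,A)$, as $A\subseteq M$). For $\sigma\subseteq\mathbb{R}^D$ let $r(\sigma)$ be the radius of the smallest ball enclosing $\sigma$, and for $t\ge 0$ let $$\operatorname{Conv}(t,A)=\bigcup_{\sigma\subseteq A,\ r(\sigma)\le t}\operatorname{Conv}(\sigma),\qquad t^*(A)=\inf\{\,0\le t<\tau(M):\ \pi_M(\operatorname{Conv}(t,A))=M\,\},$$ where $\operatorname{Conv}(\sigma)$ is the convex hull of $\sigma$. All these quantities take values in $[0,\infty]$, with $\inf\emptyset=\infty$, $\varepsilon(\emptyset)=\infty$ and $s/\infty=0$ for every $s\in[0,\infty]$. Then $$\varepsilon(A)\le t^*(A)\left(1+\frac{t^*(A)}{\tau(M)}\right).$$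 If moreover $\varepsilon(A)<\tau(M)/8$, then $$t^*(A)\le\varepsilon(A)\left(1+6\,\frac{\varepsilon(A)}{\tau(M)}\right).$$ -/

import Mathlib

open scoped ENNReal

/-- `M ⊆ ℝ^D` is a compact connected `d`-dimensional `C²` submanifold without boundary:
around each of its points a `C²` diffeomorphism between open subsets of `ℝ^D` carries `M` to a
piece of a `d`-dimensional linear subspace. -/
structure IsClosedC2Submanifold {D : ℕ} (d : ℕ) (M : Set (EuclideanSpace ℝ (Fin D))) : Prop where
  isCompact : IsCompact M
  isConnected : IsConnected M
  straighten : ∀ x ∈ M, ∃ V : Submodule ℝ (EuclideanSpace ℝ (Fin D)),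
    Module.finrank ℝ V = d ∧
    ∃ φ : OpenPartialHomeomorph (EuclideanSpace ℝ (Fin D)) (EuclideanSpace ℝ (Fin D)),
      x ∈ φ.source ∧ ContDiffOn ℝ 2 φ φ.source ∧ ContDiffOn ℝ 2 φ.symm φ.target ∧
      ∀ y ∈ φ.source, y ∈ M ↔ φ y ∈ V

/-- `y` is the projection `π_M(x)`: the unique point of `M` at distance `d(x, M)` from `x`. -/
def IsProjectionOn {D : ℕ} (M : Set (EuclideanSpace ℝ (Fin D)))
    (x y : EuclideanSpace ℝ (Fin D)) : Prop :=
  (y ∈ M ∧ dist x y = Metric.infDist x M) ∧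
    ∀ z ∈ M, dist x z = Metric.infDist x M → z = y

/-- The image `π_M(S)`. -/
def projectionImage {D : ℕ} (M S : Set (EuclideanSpace ℝ (Fin D))) :
    Set (EuclideanSpace ℝ (Fin D)) :=
  {y | ∃ x ∈ S, IsProjectionOn M x y}

/-- The reach `τ(M)`: the largest `r` such that each point at distance less than `r` from `M` has
a unique nearest point in `M`. It is `∞` if each point of the space has one. -/
noncomputable def manifoldReach {D : ℕ} (M : Set (EuclideanSpace ℝ (Fin D))) : ℝ≥0∞ :=
  sSup {r | ∀ x, Metric.infEDist x M < r → ∃ y, IsProjectionOn M x y}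

/-- The radius `r(σ)` of the smallest ball that encloses `σ`. -/
noncomputable def enclosingRadius {D : ℕ} (σ : Set (EuclideanSpace ℝ (Fin D))) : ℝ≥0∞ :=
  ⨅ z, ⨆ x ∈ σ, edist x z

/-- The `t`-convex hull `Conv(t, A)`. -/
def tConvexHull {D : ℕ} (t : ℝ≥0∞) (A : Set (EuclideanSpace ℝ (Fin D))) :
    Set (EuclideanSpace ℝ (Fin D)) :=
  {y | ∃ σ ⊆ A, enclosingRadius σ ≤ t ∧ y ∈ convexHull ℝ σ}

/-- The approximation rate `ε(A) = d_H(A, M)` (the Hausdorff distance, `∞` if just one of the two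
sets is empty). -/
noncomputable def approximationRate {D : ℕ} (M A : Set (EuclideanSpace ℝ (Fin D))) : ℝ≥0∞ :=
  Metric.hausdorffEDist A M

/-- `t*(A) = inf {t < τ(M) : π_M(Conv(t, A)) = M}`, which is `∞` if there is no such `t`. -/
noncomputable def tStar {D : ℕ} (M A : Set (EuclideanSpace ℝ (Fin D))) : ℝ≥0∞ :=
  sInf {t | t < manifoldReach M ∧ projectionImage M (tConvexHull t A) = M}

/-!
Write `r` for a number below the reach `τ`, so that points at distance less than `r` from `M` have a
unique nearest point (`UniqueNearest M r`); the inequalities are proved for such `r` and pass to the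
limit `r → τ`.

The basic tool is Federer's inequality `UniqueNearest.inner_le`: if `x` is the nearest point of `y`,
the open ball of radius `r` that touches `M` at `x` on the side of `y` contains no point of `M`.
Indeed, at a point with a unique nearest point the distance to `M` increases at rate `1` in the
direction away from it. Following this ascent from `y` (by a compactness argument instead of a
differential equation) leads to a point `z` at distance `s` from `M` and at most `s - d(y, M)` from
`y`, for any `s < r`. By the triangle inequality `z` lies on the ray from `x` through `y`, so the
ball of radius `s` around `z` is free of points of `M`.

For the first inequality, let `x ∈ M` be the projection of a point `y` in the convex hull of
`σ ⊆ A`, where `σ` lies in a ball of radius `t`. Some point of `σ` is within `t` of `y`, and Federer's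
inequality for the points of `σ` bounds the distance from `y` to `x` by `t ^ 2 / r`
(`UniqueNearest.exists_dist_le_of_mem_convexHull`).

For the second inequality the tangent spaces `T` of `M` are needed. Federer's inequality holds with
any normal vector in place of `y - x`, so `M` deviates from `x + T` by at most
`‖q - x‖ ^ 2 / (2 * r)` at `q`. Conversely, `M` has a point within `‖c‖ ^ 2 / r` of `x + c` for each
short `c ∈ T`; this is a differential inequality for the distance along the segment from `x` to
`x + c`, and it is where `M` having no boundary enters (`IsTangentSpaceAt.infDist_add_le`). Let
`ε` be slightly larger than `ε(A)`, and project the points of `A` near `x` to `T`. The projections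
are `ρ`-dense near `0` in `T` with `ρ = ε * (1 + 2 * ε / r)`. Hence `0` lies in a Delaunay cell of
circumradius less than `ρ` (`exists_ball_zero_mem_convexHull`). The vertices of this cell come from
a set `σ ⊆ A` that is contained in a ball of radius `ε * (1 + 6 * ε / r)`, and a point of the
convex hull of `σ` lies over `0`, that is, in the normal space at `x`, so that its projection is `x`.
-/

section Geometry

open Metric Filter Topology Set RealInnerProductSpace

variable {E : Type*} [NormedAddCommGroup E] [InnerProductSpace ℝ E]

/-! ### Nearest points below the reach -/

/-- Every point at distance less than `r` from `M` has at most one nearest point in `M`. -/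
def UniqueNearest (M : Set E) (r : ℝ) : Prop :=
  ∀ x, infDist x M < r → {z ∈ M | dist x z = infDist x M}.Subsingleton

/-- The nearest point depends continuously on the point, where it is unique. -/
lemma exists_nearest_dist_lt {X : Type*} [PseudoMetricSpace X] {M : Set X}
    (hM : IsCompact M) {q p : X} (hp : p ∈ M)
    (hqp : dist q p = infDist q M)
    (huniq : {z ∈ M | dist q z = infDist q M}.Subsingleton) {η : ℝ} (hη : 0 < η) :
    ∃ δ > 0, ∀ q', dist q' q < δ → ∀ p' ∈ M, dist q' p' = infDist q' M → dist p' p < η := by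
  have hK : IsCompact (M \ ball p η) := hM.diff isOpen_ball
  rcases (M \ ball p η).eq_empty_or_nonempty with hemp | hne
  · refine ⟨1, one_pos, fun q' _ p' hp' _ => ?_⟩
    by_contra h
    have : p' ∈ M \ ball p η := ⟨hp', by simpa using h⟩
    simp [hemp] at this
  · obtain ⟨k, hk, hkd⟩ := hK.exists_infDist_eq_dist hne q
    have hlt : infDist q M < dist q k := by
      refine lt_of_le_of_ne (infDist_le_dist_of_mem hk.1) fun h => hk.2 ?_
      rw [huniq ⟨hk.1, h.symm⟩ ⟨hp, hqp⟩]
      exact mem_ball_self hη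
    refine ⟨(dist q k - infDist q M) / 2, by linarith, fun q' hq' p' hp' hd => ?_⟩
    by_contra h
    have hmem : p' ∈ M \ ball p η := ⟨hp', by simpa using h⟩
    have h1 : dist q k ≤ dist q p' := hkd ▸ infDist_le_dist_of_mem hmem
    have h2 : infDist q' M ≤ infDist q M + dist q' q := infDist_le_infDist_add_dist
    have h3 := dist_triangle q q' p'
    rw [dist_comm q q'] at h3
    linarith

/-- Where the nearest point is unique, the distance to `M` grows at a rate arbitrarily close
to `1`: the direction away from the nearest point does it. -/
lemma exists_infDist_ascent {M : Set E} (hM : IsCompact M) {q p : E} (hp : p ∈ M)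
    (hqp : dist q p = infDist q M) (hpos : 0 < infDist q M)
    (huniq : {z ∈ M | dist q z = infDist q M}.Subsingleton) {c : ℝ} (hc : c < 1) {η : ℝ}
    (hη : 0 < η) :
    ∃ q', q' ≠ q ∧ dist q' q < η ∧ infDist q M + c * dist q' q ≤ infDist q' M := by
  have hnorm : ‖q - p‖ = infDist q M := by rw [← dist_eq_norm, hqp]
  set δ := infDist q M with hδ
  set u : E := δ⁻¹ • (q - p) with hu
  have hunorm : ‖u‖ = 1 := by
    rw [hu, norm_smul, norm_inv, Real.norm_of_nonneg hpos.le, hnorm, inv_mul_cancel₀ hpos.ne']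
  have hcont : Continuous fun z : E => ⟪u, q - z⟫ - c * ‖q - z‖ := by fun_prop
  have hp0 : 0 < ⟪u, q - p⟫ - c * ‖q - p‖ := by
    rw [hu, inner_smul_left, real_inner_self_eq_norm_sq, hnorm]
    have : (starRingEnd ℝ) δ⁻¹ * δ ^ 2 = δ := by simp; field_simp
    rw [this]
    nlinarith
  obtain ⟨η', hη', hball⟩ := Metric.eventually_nhds_iff.1
    (hcont.continuousAt.eventually (lt_mem_nhds hp0))
  obtain ⟨ζ, hζ, hnear⟩ := exists_nearest_dist_lt hM hp hqp huniq hη'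
  set h := min (ζ / 2) (η / 2) with hh
  have hhpos : 0 < h := by positivity
  have hdist : dist (q + h • u) q = h := by
    rw [dist_eq_norm, add_sub_cancel_left, norm_smul, hunorm, mul_one,
      Real.norm_of_nonneg hhpos.le]
  refine ⟨q + h • u, fun hEq => ?_, ?_, ?_⟩
  · rw [hEq, dist_self] at hdist; exact hhpos.ne hdist
  · rw [hdist]; linarith [min_le_right (ζ / 2) (η / 2)]
  obtain ⟨p', hp', hd'⟩ := hM.exists_infDist_eq_dist ⟨p, hp⟩ (q + h • u)
  have hclose : dist p' p < η' :=
    hnear _ (by rw [hdist]; linarith [min_le_left (ζ / 2) (η / 2)]) p' hp' hd'.symm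
  have hin := hball hclose
  have hge : δ ≤ ‖q - p'‖ := by rw [← dist_eq_norm]; exact infDist_le_dist_of_mem hp'
  have hcs := real_inner_le_norm (q + h • u - p') (q - p')
  have hexp : ⟪q + h • u - p', q - p'⟫ = ‖q - p'‖ ^ 2 + h * ⟪u, q - p'⟫ := by
    rw [show q + h • u - p' = (q - p') + h • u by abel, inner_add_left,
      real_inner_self_eq_norm_sq, inner_smul_left]
    simp
  rw [hdist, hd', dist_eq_norm]
  rw [hexp] at hcs
  have h1 : h * (c * ‖q - p'‖) ≤ h * ⟪u, q - p'⟫ := by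
    apply mul_le_mul_of_nonneg_left _ hhpos.le
    linarith
  have h2 : (‖q - p'‖ + c * h) * ‖q - p'‖ ≤ ‖q + h • u - p'‖ * ‖q - p'‖ := by
    nlinarith
  have h3 := le_of_mul_le_mul_right h2 (by linarith)
  linarith

section Proper

variable [FiniteDimensional ℝ E]

/-- Below the reach, every value `s` of the distance to `M` is attained within `s - infDist y M`
of `y`. The point is a maximum of the distance over the points that `y` can be joined to by an
ascent of slope at least `c`, with `c` tending to `1`. -/
lemma UniqueNearest.exists_infDist_eq {M : Set E} (hM : IsCompact M) {r : ℝ}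
    (hr : UniqueNearest M r) {y : E} (hy : 0 < infDist y M) {s : ℝ} (hys : infDist y M ≤ s)
    (hs : s < r) : ∃ q, infDist q M = s ∧ dist q y ≤ s - infDist y M := by
  have hMne : M.Nonempty := by
    by_contra h
    rw [not_nonempty_iff_eq_empty] at h
    simp [h] at hy
  have hcontd : Continuous fun q => infDist q M := continuous_infDist_pt M
  have key : ∀ c : ℝ, 0 < c → c < 1 → ∃ q, infDist q M = s ∧ c * dist q y ≤ s - infDist y M := by
    intro c hc0 hc1
    set S : Set E := {q | infDist q M ≤ s ∧ infDist y M + c * dist q y ≤ infDist q M} with hS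
    have hSc : IsCompact S := by
      refine (isCompact_closedBall y (s / c)).of_isClosed_subset ?_ ?_
      · exact (isClosed_le hcontd continuous_const).inter
          (isClosed_le (by fun_prop) hcontd)
      · rintro q ⟨h1, h2⟩
        rw [mem_closedBall, le_div_iff₀ hc0]
        linarith
    obtain ⟨q, hq, hmax⟩ := hSc.exists_isMaxOn ⟨y, hys, by simp⟩ hcontd.continuousOn
    have hqs : infDist q M = s := by
      by_contra hne
      have hlt : infDist q M < s := lt_of_le_of_ne hq.1 hne
      obtain ⟨p, hp, hqp⟩ := hM.exists_infDist_eq_dist hMne q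
      have hqpos : 0 < infDist q M := by
        have := mul_nonneg hc0.le (dist_nonneg (x := q) (y := y))
        linarith [hq.2]
      obtain ⟨q', hne', hd', hasc⟩ := exists_infDist_ascent hM hp hqp.symm hqpos
        (hr q (hlt.trans hs)) hc1 (sub_pos.2 hlt)
      have hq'pos : 0 < dist q' q := dist_pos.2 hne'
      have h1 : infDist q' M ≤ infDist q M + dist q' q := infDist_le_infDist_add_dist
      have h2 : q' ∈ S := by
        refine ⟨by linarith, ?_⟩
        have := mul_le_mul_of_nonneg_left (dist_triangle q' q y) hc0.le
        linarith [hq.2]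
      have h3 : infDist q' M ≤ infDist q M := hmax h2
      nlinarith
    exact ⟨q, hqs, by linarith [hq.2]⟩
  obtain ⟨q₁, hq₁, -⟩ := key (1 / 2) (by norm_num) (by norm_num)
  obtain ⟨q₀, hq₀, hmin⟩ := (isClosed_eq hcontd continuous_const : IsClosed {q | infDist q M = s})
    |>.exists_infDist_eq_dist ⟨q₁, hq₁⟩ y
  refine ⟨q₀, hq₀, ?_⟩
  have hle : ∀ c : ℝ, 0 < c → c < 1 → c * dist q₀ y ≤ s - infDist y M := by
    intro c hc0 hc1
    obtain ⟨q, hq, hqy⟩ := key c hc0 hc1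
    refine le_trans (mul_le_mul_of_nonneg_left ?_ hc0.le) hqy
    rw [dist_comm q₀, dist_comm q, ← hmin]
    exact infDist_le_dist_of_mem hq
  have htend : Tendsto (fun c : ℝ => c * dist q₀ y) (𝓝[<] 1) (𝓝 (1 * dist q₀ y)) :=
    ((continuous_id.mul continuous_const).tendsto 1).mono_left nhdsWithin_le_nhds
  rw [one_mul] at htend
  refine le_of_tendsto htend ?_
  filter_upwards [Ioo_mem_nhdsLT (zero_lt_one' ℝ)] with c hc using hle c hc.1 hc.2

/-- If `x` is a nearest point of `y`, the open ball of any radius `s < r` which touches `M` at `x`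
and has its centre on the ray from `x` through `y` contains no point of `M`. -/
lemma UniqueNearest.le_norm_sub {M : Set E} (hM : IsCompact M) {r : ℝ}
    (hr : UniqueNearest M r) {x y : E} (hx : x ∈ M) (hxy : dist y x = infDist y M)
    (hy : 0 < infDist y M) {s : ℝ} (hys : infDist y M ≤ s) (hs : s < r) {q : E} (hq : q ∈ M) :
    s ≤ ‖q - x - (s / infDist y M) • (y - x)‖ := by
  obtain ⟨z, hz, hzy⟩ := hr.exists_infDist_eq hM hy hys hs
  have h1 : s ≤ ‖z - x‖ := by
    rw [← hz, ← dist_eq_norm]; exact infDist_le_dist_of_mem hx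
  have h2 : ‖y - x‖ = infDist y M := by rw [← dist_eq_norm, hxy]
  have h3 : ‖(z - x) - (y - x)‖ ≤ s - infDist y M := by
    rw [sub_sub_sub_cancel_right, ← dist_eq_norm]; exact hzy
  set δ := infDist y M with hδ
  -- `z` attains equality in the triangle inequality through `y`, hence lies on the ray
  have h4 : ‖z - x‖ ≤ s := by
    have := norm_add_le ((z - x) - (y - x)) (y - x)
    rw [sub_add_cancel] at this
    linarith
  have h5 : ‖z - x‖ = s := le_antisymm h4 h1
  have h6 : s * δ ≤ ⟪z - x, y - x⟫ := by
    have := pow_le_pow_left₀ (norm_nonneg _) h3 2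
    rw [norm_sub_sq_real, h5, h2] at this
    nlinarith
  have h7 : z - x = (s / δ) • (y - x) := by
    rw [← sub_eq_zero, ← norm_eq_zero, ← sq_eq_zero_iff]
    refine le_antisymm ?_ (sq_nonneg _)
    rw [norm_sub_sq_real, h5, norm_smul, h2, inner_smul_right,
      Real.norm_of_nonneg (div_nonneg (hy.le.trans hys) hy.le), div_mul_cancel₀ _ hy.ne']
    have : s * s ≤ s / δ * ⟪z - x, y - x⟫ := by
      calc s * s = s / δ * (s * δ) := by field_simp
        _ ≤ _ := mul_le_mul_of_nonneg_left h6 (div_nonneg (hy.le.trans hys) hy.le)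
    nlinarith
  rw [← h7, sub_sub_sub_cancel_right, ← dist_eq_norm, dist_comm, ← hz]
  exact infDist_le_dist_of_mem hq

/-- Federer's inequality: the ball of radius `r` that touches `M` at a nearest point `x` of `y`,
on the side of `y`, contains no point of `M`. -/
lemma UniqueNearest.inner_le {M : Set E} (hM : IsCompact M) {r : ℝ}
    (hr : UniqueNearest M r) {x y : E} (hx : x ∈ M) (hxy : dist y x = infDist y M)
    (hyr : infDist y M < r) {q : E} (hq : q ∈ M) :
    2 * r * ⟪q - x, y - x⟫ ≤ ‖y - x‖ * ‖q - x‖ ^ 2 := by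
  rcases (infDist_nonneg (x := y) (s := M)).eq_or_lt with h0 | hpos
  · rw [← h0, dist_eq_zero] at hxy
    simp [hxy]
  have h2 : ‖y - x‖ = infDist y M := by rw [← dist_eq_norm, hxy]
  have htend : Tendsto (fun s : ℝ => 2 * s * ⟪q - x, y - x⟫) (𝓝[<] r)
      (𝓝 (2 * r * ⟪q - x, y - x⟫)) :=
    (Continuous.tendsto (by fun_prop) r).mono_left nhdsWithin_le_nhds
  refine le_of_tendsto htend ?_
  filter_upwards [Ioo_mem_nhdsLT hyr] with s hs
  have h := hr.le_norm_sub hM hx hxy hpos hs.1.le hs.2 hq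
  have hspos : 0 < s := hpos.trans hs.1
  have hsq := pow_le_pow_left₀ hspos.le h 2
  rw [norm_sub_sq_real, norm_smul, h2, inner_smul_right,
    Real.norm_of_nonneg (div_nonneg hspos.le hpos.le), div_mul_cancel₀ _ hpos.ne'] at hsq
  have h8 : 2 * (s / infDist y M * ⟪q - x, y - x⟫) ≤ ‖q - x‖ ^ 2 := by linarith
  calc 2 * s * ⟪q - x, y - x⟫ = infDist y M * (2 * (s / infDist y M * ⟪q - x, y - x⟫)) := by
        field_simp
    _ ≤ _ := by rw [h2]; exact mul_le_mul_of_nonneg_left h8 hpos.le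

end Proper

end Geometry

section Tangent

open Metric Filter Topology Set RealInnerProductSpace

variable {E : Type*} [NormedAddCommGroup E] [InnerProductSpace ℝ E]

/-! ### Tangent spaces -/

/-- `T` is the tangent space of `M` at `x`, with the two properties of a `C²` submanifold that are
used of it: `M` has points at distance `o(h)` from `x + h • v` for each `v ∈ T`, and near `x`
it deviates from `x + T` to second order only. -/
structure IsTangentSpaceAt (M : Set E) (x : E) (T : Submodule ℝ E) : Prop where
  approx : ∀ v ∈ T, ∀ η > 0, ∀ᶠ h in 𝓝[>] (0 : ℝ), infDist (x + h • v) M ≤ η * h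
  normal : ∃ C, ∀ᶠ q in 𝓝 x, q ∈ M → ∀ w ∈ Tᗮ, ⟪q - x, w⟫ ≤ C * ‖q - x‖ ^ 2 * ‖w‖

/-- Taylor's estimate of order two for a `C²` map. -/
lemma exists_norm_sub_fderiv_le {F : Type*} [NormedAddCommGroup F] [NormedSpace ℝ F]
    {ψ : E → F} {a : E} (h : ContDiffAt ℝ 2 ψ a) :
    ∃ K : ℝ, 0 ≤ K ∧ ∀ᶠ b in 𝓝 a, ‖ψ b - ψ a - fderiv ℝ ψ a (b - a)‖ ≤ K * ‖b - a‖ ^ 2 := by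
  obtain ⟨K, t, ht, hK⟩ :=
    (h.fderiv_right (m := 1) (by norm_num)).exists_lipschitzOnWith
  have hdiff : ∀ᶠ b in 𝓝 a, DifferentiableAt ℝ ψ b :=
    (h.eventually (by simp)).mono fun b hb => hb.differentiableAt (by simp)
  obtain ⟨ρ, hρ, hball⟩ := Metric.eventually_nhds_iff.1 (hdiff.and ht)
  refine ⟨K, K.2, Metric.eventually_nhds_iff.2 ⟨ρ, hρ, fun b hb => ?_⟩⟩
  have hsub : ∀ z ∈ closedBall a ‖b - a‖, dist z a < ρ := fun z hz => by
    rw [mem_closedBall, ← dist_eq_norm b a] at hz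
    exact hz.trans_lt hb
  have := (convex_closedBall a ‖b - a‖).norm_image_sub_le_of_norm_hasFDerivWithin_le'
    (f := ψ) (f' := fderiv ℝ ψ) (φ := fderiv ℝ ψ a) (C := K * ‖b - a‖) (x := a) (y := b)
    (fun z hz => (hball (hsub z hz)).1.hasFDerivAt.hasFDerivWithinAt)
    (fun z hz => ?_) (mem_closedBall_self (norm_nonneg _)) (by simp [dist_eq_norm])
  · calc _ ≤ _ := this
      _ = _ := by ring
  · rw [← dist_eq_norm]
    refine (hK.dist_le_mul z (hball (hsub z hz)).2 a (mem_of_mem_nhds ht)).trans ?_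
    exact mul_le_mul_of_nonneg_left hz K.2

/-- The tangent space of a set which a `C²` diffeomorphism straightens to a linear subspace. -/
lemma exists_isTangentSpaceAt [CompleteSpace E] {M : Set E} {x : E} (hx : x ∈ M)
    {V : Submodule ℝ E} (φ : OpenPartialHomeomorph E E) (hxs : x ∈ φ.source)
    (hφ : ContDiffOn ℝ 2 φ φ.source) (hψ : ContDiffOn ℝ 2 φ.symm φ.target)
    (hV : ∀ y ∈ φ.source, y ∈ M ↔ φ y ∈ V) : ∃ T, IsTangentSpaceAt M x T := by
  set a := φ x with ha
  have hat : a ∈ φ.target := φ.map_source hxs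
  have haV : a ∈ V := (hV x hxs).1 hx
  have hψa : φ.symm a = x := φ.left_inv hxs
  have hψ2 : ContDiffAt ℝ 2 φ.symm a := hψ.contDiffAt (φ.open_target.mem_nhds hat)
  have hφ2 : ContDiffAt ℝ 2 φ x := hφ.contDiffAt (φ.open_source.mem_nhds hxs)
  refine ⟨V.map (fderiv ℝ φ.symm a).toLinearMap, ?_, ?_⟩
  · rintro _ ⟨e, he, rfl⟩ η hη
    have hline : HasDerivAt (fun h : ℝ => a + h • e) e 0 := by
      simpa using ((hasDerivAt_id (0 : ℝ)).smul_const e).const_add a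
    have hd : HasDerivAt (fun h : ℝ => φ.symm (a + h • e)) (fderiv ℝ φ.symm a e) 0 := by
      have h0 : HasFDerivAt φ.symm (fderiv ℝ φ.symm a) (a + (0 : ℝ) • e) := by
        rw [zero_smul, add_zero]
        exact (hψ2.differentiableAt (by simp)).hasFDerivAt
      exact h0.comp_hasDerivAt (0 : ℝ) hline
    have hcont : Tendsto (fun h : ℝ => a + h • e) (𝓝 0) (𝓝 a) := by
      simpa using hline.continuousAt.tendsto
    have hev := (hasDerivAt_iff_isLittleO.1 hd).def hη
    filter_upwards [nhdsWithin_le_nhds hev, self_mem_nhdsWithin,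
      nhdsWithin_le_nhds (hcont (φ.open_target.mem_nhds hat))] with h h1 h2 h3
    have hmem : φ.symm (a + h • e) ∈ M := by
      rw [hV _ (φ.map_target h3), φ.right_inv h3]
      exact V.add_mem haV (V.smul_mem h he)
    refine (infDist_le_dist_of_mem hmem).trans ?_
    rw [dist_comm, dist_eq_norm]
    simp only [zero_smul, add_zero, sub_zero, hψa, Real.norm_of_nonneg (le_of_lt h2)] at h1
    rw [← sub_sub]
    exact h1
  · obtain ⟨K, hK0, hK⟩ := exists_norm_sub_fderiv_le hψ2
    obtain ⟨L, t, ht, hL⟩ := (hφ2.of_le (by norm_num : (1 : WithTop ℕ∞) ≤ 2)).exists_lipschitzOnWith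
    refine ⟨K * L ^ 2, ?_⟩
    filter_upwards [hφ2.continuousAt.eventually hK, ht, φ.open_source.mem_nhds hxs]
      with q h1 h2 h3 hqM w hw
    rw [φ.left_inv h3, hψa] at h1
    have hlip : ‖φ q - a‖ ≤ L * ‖q - x‖ := by
      rw [← dist_eq_norm, ← dist_eq_norm]
      exact hL.dist_le_mul q h2 x (mem_of_mem_nhds ht)
    have horth : ⟪fderiv ℝ φ.symm a (φ q - a), w⟫ = 0 :=
      hw _ ⟨_, V.sub_mem ((hV q h3).1 hqM) haV, rfl⟩
    calc ⟪q - x, w⟫ = ⟪q - x - fderiv ℝ φ.symm a (φ q - a), w⟫ := by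
          rw [inner_sub_left (q - x), horth, sub_zero]
      _ ≤ ‖q - x - fderiv ℝ φ.symm a (φ q - a)‖ * ‖w‖ := real_inner_le_norm _ _
      _ ≤ K * L ^ 2 * ‖q - x‖ ^ 2 * ‖w‖ := by
          refine mul_le_mul_of_nonneg_right (h1.trans ?_) (norm_nonneg _)
          calc K * ‖φ q - a‖ ^ 2 ≤ K * (L * ‖q - x‖) ^ 2 := by gcongr
            _ = _ := by ring

/-- A point is displaced orthogonally to the tangent space from its nearest points. -/
lemma IsTangentSpaceAt.sub_mem_orthogonal {M : Set E} {x y : E} {T : Submodule ℝ E}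
    (hT : IsTangentSpaceAt M x T) (hxy : dist y x = infDist y M) : y - x ∈ Tᗮ := by
  rcases eq_or_ne y x with rfl | hne
  · simp
  have hδ : 0 < ‖y - x‖ := norm_pos_iff.2 (sub_ne_zero.2 hne)
  have hle : ∀ v ∈ T, ⟪v, y - x⟫ ≤ 0 := by
    intro v hv
    refine le_of_forall_pos_le_add fun ζ hζ => ?_
    set η := ζ / (2 * ‖y - x‖) with hη
    have hηpos : 0 < η := by positivity
    have hev : ∀ᶠ h in 𝓝[>] (0 : ℝ), h * ‖v‖ ^ 2 < ζ := by
      refine nhdsWithin_le_nhds ((Continuous.tendsto ?_ (0 : ℝ)).eventually (gt_mem_nhds ?_))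
      · fun_prop
      · simpa using hζ
    have hev2 : ∀ᶠ h in 𝓝[>] (0 : ℝ), η * h < ‖y - x‖ := by
      refine nhdsWithin_le_nhds ((Continuous.tendsto ?_ (0 : ℝ)).eventually (gt_mem_nhds ?_))
      · fun_prop
      · simpa using hδ
    obtain ⟨h, ⟨h1, h2⟩, h3, h4⟩ :=
      (((hT.approx v hv η hηpos).and hev).and (hev2.and self_mem_nhdsWithin)).exists
    have hhpos : 0 < h := h4
    have h5 : infDist y M ≤ infDist (x + h • v) M + dist y (x + h • v) :=
      infDist_le_infDist_add_dist
    rw [← hxy, dist_eq_norm, dist_eq_norm, ← sub_sub] at h5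
    have h6 : ‖y - x‖ - η * h ≤ ‖y - x - h • v‖ := by linarith
    have h7 := pow_le_pow_left₀ (by linarith) h6 2
    rw [norm_sub_sq_real, inner_smul_right, norm_smul, Real.norm_of_nonneg hhpos.le,
      real_inner_comm] at h7
    have h8 : η * ‖y - x‖ * 2 = ζ := by rw [hη]; field_simp
    have h9 : h * (2 * ⟪v, y - x⟫) ≤ h * (2 * ζ) := by
      nlinarith [sq_nonneg (η * h)]
    have := le_of_mul_le_mul_left h9 hhpos
    linarith
  intro v hv
  refine le_antisymm (hle v hv) ?_
  have := hle (-v) (T.neg_mem hv)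
  rw [inner_neg_left] at this
  linarith

section Proper

variable [FiniteDimensional ℝ E]

/-- For every normal vector `w` at `x`, the ball of radius `r` that touches `M` at `x` on the side
of `w` contains no point of `M`: by the second order bound a small multiple of `w` leads to a point
whose nearest point is `x`, so that Federer's inequality applies. -/
lemma IsTangentSpaceAt.inner_le {M : Set E} (hM : IsCompact M) {r : ℝ} (hr0 : 0 < r)
    (hr : UniqueNearest M r) {x : E} (hx : x ∈ M) {T : Submodule ℝ E}
    (hT : IsTangentSpaceAt M x T) {w : E} (hw : w ∈ Tᗮ) {q : E} (hq : q ∈ M) :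
    2 * r * ⟪q - x, w⟫ ≤ ‖w‖ * ‖q - x‖ ^ 2 := by
  rcases eq_or_ne w 0 with rfl | hw0
  · simp
  have hwpos : 0 < ‖w‖ := norm_pos_iff.2 hw0
  obtain ⟨C, hC⟩ := hT.normal
  obtain ⟨η, hη, hball⟩ := Metric.eventually_nhds_iff.1 hC
  have e1 : ∀ᶠ h in 𝓝[>] (0 : ℝ), h * (2 * ‖w‖) < η :=
    nhdsWithin_le_nhds ((Continuous.tendsto (by fun_prop) (0 : ℝ)).eventually
      (gt_mem_nhds (by simpa using hη)))
  have e2 : ∀ᶠ h in 𝓝[>] (0 : ℝ), h * (2 * C * ‖w‖) < 1 :=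
    nhdsWithin_le_nhds ((Continuous.tendsto (by fun_prop) (0 : ℝ)).eventually
      (gt_mem_nhds (by simp)))
  have e3 : ∀ᶠ h in 𝓝[>] (0 : ℝ), h * ‖w‖ < r :=
    nhdsWithin_le_nhds ((Continuous.tendsto (by fun_prop) (0 : ℝ)).eventually
      (gt_mem_nhds (by simpa using hr0)))
  obtain ⟨h, ⟨h1, h2⟩, h3, h4⟩ := ((e1.and e2).and (e3.and self_mem_nhdsWithin)).exists
  have hpos : 0 < h := h4
  have hnorm : ‖h • w‖ = h * ‖w‖ := by rw [norm_smul, Real.norm_of_nonneg hpos.le]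
  have hdist : dist (x + h • w) x = h * ‖w‖ := by
    rw [dist_eq_norm, add_sub_cancel_left, hnorm]
  have hnear : dist (x + h • w) x = infDist (x + h • w) M := by
    refine le_antisymm ?_ (infDist_le_dist_of_mem hx)
    rw [le_infDist ⟨x, hx⟩, hdist]
    intro p hp
    by_contra hlt
    push Not at hlt
    have hpx : dist p x < η := by
      have := dist_triangle_left p x (x + h • w)
      rw [hdist] at this
      linarith
    have h5 := hball hpx hp w hw
    have h6 : (h * ‖w‖) ^ 2 ≤ ‖p - x - h • w‖ ^ 2 := by
      rw [norm_sub_sq_real, inner_smul_right, hnorm]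
      have h7 := mul_le_mul_of_nonneg_left h5 hpos.le
      have h8 := mul_le_mul_of_nonneg_right h2.le (sq_nonneg ‖p - x‖)
      nlinarith
    have h7 := abs_le_of_sq_le_sq' h6 (norm_nonneg _)
    rw [dist_comm, dist_eq_norm, ← sub_sub] at hlt
    linarith [h7.2]
  have := hr.inner_le hM hx hnear (by rw [← hnear, hdist]; exact h3) hq
  rw [add_sub_cancel_left, inner_smul_right, hnorm] at this
  refine le_of_mul_le_mul_left ?_ hpos
  linarith

/-- The nearest point of `y` is `x` if `y - x` is normal at `x` and shorter than the reach. -/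
lemma IsTangentSpaceAt.dist_lt_of_ne {M : Set E} (hM : IsCompact M) {r : ℝ}
    (hr : UniqueNearest M r) {x y : E} (hx : x ∈ M) {T : Submodule ℝ E}
    (hT : IsTangentSpaceAt M x T) (hw : y - x ∈ Tᗮ) (hyr : ‖y - x‖ < r) {q : E} (hq : q ∈ M)
    (hqx : q ≠ x) : dist y x < dist y q := by
  have hr0 : 0 < r := (norm_nonneg _).trans_lt hyr
  have h := hT.inner_le hM hr0 hr hx hw hq
  have hpos : 0 < ‖q - x‖ ^ 2 := by
    have := norm_pos_iff.2 (sub_ne_zero.2 hqx)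
    positivity
  have h1 : 2 * ⟪q - x, y - x⟫ < ‖q - x‖ ^ 2 := by
    have : r * (2 * ⟪q - x, y - x⟫) < r * ‖q - x‖ ^ 2 := by nlinarith
    exact lt_of_mul_lt_mul_left this hr0.le
  rw [dist_comm y q, dist_eq_norm, dist_eq_norm, ← sub_sub_sub_cancel_right q y x]
  refine lt_of_pow_lt_pow_left₀ 2 (norm_nonneg _) ?_
  rw [norm_sub_sq_real (q - x)]
  linarith

/-- The distance of `q - x` from the tangent space at `x` is at most `‖q - x‖² / (2 * r)`. -/
lemma IsTangentSpaceAt.norm_sub_starProjection_le {M : Set E} (hM : IsCompact M) {r : ℝ}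
    (hr0 : 0 < r) (hr : UniqueNearest M r) {x : E} (hx : x ∈ M) {T : Submodule ℝ E}
    (hT : IsTangentSpaceAt M x T) {q : E} (hq : q ∈ M) :
    2 * r * ‖(q - x) - T.starProjection (q - x)‖ ≤ ‖q - x‖ ^ 2 := by
  set n := (q - x) - T.starProjection (q - x) with hn
  have hnT : n ∈ Tᗮ := T.sub_starProjection_mem_orthogonal _
  have h := hT.inner_le hM hr0 hr hx hnT hq
  have h1 : ⟪q - x, n⟫ = ‖n‖ ^ 2 := by
    have h2 : ⟪T.starProjection (q - x), n⟫ = 0 := hnT _ (T.starProjection_apply_mem _)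
    have h3 : ⟪n, n⟫ = ⟪q - x, n⟫ - ⟪T.starProjection (q - x), n⟫ := by rw [← inner_sub_left]
    rw [← real_inner_self_eq_norm_sq, h3, h2, sub_zero]
  rw [h1] at h
  rcases (norm_nonneg n).eq_or_lt with h0 | h0
  · simp [← h0]
  · refine le_of_mul_le_mul_left ?_ h0
    linarith

/-- Let every point of `M` have a tangent space. Then `M` follows its tangent space at `x` to
second order on a ball of radius `r / 4`.

Along a segment `x + s • c`, let `m` be the nearest point and `δ` the distance. The displacement
is normal at `m`, so the ball of radius `r` touching `M` at `m` on the far side does not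
contain `x`; this reads `s * δ' ≤ δ + ‖x - m‖² / (2 * r)`, and the claim follows by comparison with
`s ↦ η * s + s² * ‖c‖² / r` for small `η`. -/
lemma IsTangentSpaceAt.infDist_add_le {M : Set E} (hM : IsCompact M) {r : ℝ}
    (hr0 : 0 < r) (hr : UniqueNearest M r) (htan : ∀ m ∈ M, ∃ T, IsTangentSpaceAt M m T)
    {x : E} (hx : x ∈ M) {T : Submodule ℝ E} (hT : IsTangentSpaceAt M x T) {c : E} (hc : c ∈ T)
    (hcr : ‖c‖ ≤ r / 4) : infDist (x + c) M ≤ ‖c‖ ^ 2 / r := by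
  rcases eq_or_ne c 0 with rfl | hc0
  · simp [infDist_zero_of_mem hx]
  have hL : 0 < ‖c‖ := norm_pos_iff.2 hc0
  set L := ‖c‖ with hLdef
  set f : ℝ → ℝ := fun s => infDist (x + s • c) M with hf
  have hfcont : Continuous f := (continuous_infDist_pt M).comp (by fun_prop)
  have main : ∀ η : ℝ, 0 < η → η ≤ L / 8 → f 1 ≤ η + L ^ 2 / r := by
    intro η hη hη8
    have hslope : ∀ s ∈ Ico (0 : ℝ) 1, ∃ g : ℝ,
        (∀ ρ, g < ρ → ∃ᶠ z in 𝓝[>] s, slope f s z < ρ) ∧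
        (f s = η * s + s ^ 2 * (L ^ 2 / r) → g < η + 2 * s * (L ^ 2 / r)) := by
      rintro s ⟨hs0, hs1⟩
      by_cases hfs : f s = η * s + s ^ 2 * (L ^ 2 / r)
      swap
      · refine ⟨L, fun ρ hρ => Eventually.frequently ?_, fun h => absurd h hfs⟩
        filter_upwards [self_mem_nhdsWithin] with z hz
        have hz' : 0 < z - s := sub_pos.2 hz
        refine lt_of_le_of_lt ?_ hρ
        rw [slope_def_field, div_le_iff₀ hz', sub_le_iff_le_add]
        have : infDist (x + z • c) M ≤ infDist (x + s • c) M + dist (x + z • c) (x + s • c) :=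
          infDist_le_infDist_add_dist
        rw [dist_eq_norm, add_sub_add_left_eq_sub, ← sub_smul, norm_smul,
          Real.norm_of_nonneg hz'.le] at this
        simp only [hf]
        linarith
      rcases hs0.eq_or_lt with rfl | hs0
      · refine ⟨0, fun ρ hρ => Eventually.frequently ?_, fun _ => by simpa using hη⟩
        filter_upwards [hT.approx c hc (ρ / 2) (by positivity), self_mem_nhdsWithin] with z hz1 hz2
        have hz2 : 0 < z := hz2
        have h0 : f 0 = 0 := by simp [hf, infDist_zero_of_mem hx]
        rw [slope_def_field, h0, sub_zero, sub_zero, div_lt_iff₀ hz2]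
        have := mul_pos hρ hz2
        simp only [hf]
        linarith
      · have hLr : 0 < L ^ 2 / r := by positivity
        have hδ : 0 < f s := by rw [hfs]; positivity
        obtain ⟨m, hm, hdm⟩ := hM.exists_infDist_eq_dist ⟨x, hx⟩ (x + s • c)
        obtain ⟨Tm, hTm⟩ := htan m hm
        set w := x + s • c - m with hw
        set δ := f s with hδdef
        have hwn : ‖w‖ = δ := by rw [hw, ← dist_eq_norm, ← hdm]
        have hwT : w ∈ Tmᗮ := hTm.sub_mem_orthogonal hdm.symm
        refine ⟨⟪w, c⟫ / δ, fun ρ hρ => Eventually.frequently ?_, fun _ => ?_⟩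
        · have hev : ∀ᶠ z in 𝓝[>] s, ⟪w, c⟫ / δ + (z - s) * L ^ 2 / (2 * δ) < ρ := by
            refine nhdsWithin_le_nhds ((Continuous.tendsto ?_ s).eventually (gt_mem_nhds ?_))
            · fun_prop
            · simpa using hρ
          filter_upwards [hev, self_mem_nhdsWithin] with z hz1 hz2
          have hz' : 0 < z - s := sub_pos.2 hz2
          refine lt_of_le_of_lt ?_ hz1
          rw [slope_def_field, div_le_iff₀ hz', sub_le_iff_le_add]
          have h1 : f z ≤ ‖w + (z - s) • c‖ := by
            have : w + (z - s) • c = x + z • c - m := by rw [hw, sub_smul]; abel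
            rw [this, ← dist_eq_norm]
            exact infDist_le_dist_of_mem hm
          have h2 : ‖w + (z - s) • c‖ ^ 2 = δ ^ 2 + 2 * ((z - s) * ⟪w, c⟫) + ((z - s) * L) ^ 2 := by
            rw [norm_add_sq_real, inner_smul_right, norm_smul, Real.norm_of_nonneg hz'.le, hwn]
          -- the square root is concave: `u ≤ (u² + δ²) / (2 * δ)`
          have h3 : 2 * δ * ‖w + (z - s) • c‖ ≤ ‖w + (z - s) • c‖ ^ 2 + δ ^ 2 := by
            nlinarith [sq_nonneg (‖w + (z - s) • c‖ - δ)]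
          have h4 : ((⟪w, c⟫ / δ + (z - s) * L ^ 2 / (2 * δ)) * (z - s) + f s) * (2 * δ)
              = 2 * δ ^ 2 + 2 * ((z - s) * ⟪w, c⟫) + ((z - s) * L) ^ 2 := by
            rw [← hδdef]; field_simp; ring
          refine h1.trans (le_of_mul_le_mul_right ?_ (by positivity : 0 < 2 * δ))
          rw [h4]
          linarith
        · -- the ball touching `M` at `m` on the side of `-w` does not contain `x`
          have h1 := hTm.inner_le hM hr0 hr hm (Tmᗮ.neg_mem hwT) hx
          have hxm : x - m = w - s • c := by rw [hw]; abel
          rw [norm_neg, hwn, hxm, inner_neg_right, inner_sub_left, real_inner_self_eq_norm_sq,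
            hwn, inner_smul_left, real_inner_comm] at h1
          simp only [conj_trivial] at h1
          have h2 : ‖w - s • c‖ ≤ δ + s * L := by
            have := norm_sub_le w (s • c)
            rwa [hwn, norm_smul, Real.norm_of_nonneg hs0.le] at this
          have h3 : ‖w - s • c‖ ^ 2 < 2 * (s * L) ^ 2 := by
            have h5 : s ^ 2 * (L ^ 2 / r) ≤ s * L * (1 / 4) := by
              have : L ^ 2 / r ≤ L / 4 := by
                rw [div_le_iff₀ hr0]; nlinarith
              have h6 : s ^ 2 * (L ^ 2 / r) ≤ s * (L / 4) := by
                rw [sq, mul_assoc]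
                refine mul_le_mul_of_nonneg_left (le_trans ?_ this) hs0.le
                exact mul_le_of_le_one_left hLr.le hs1.le
              linarith
            have h6 : δ ≤ s * L * (3 / 8) := by rw [hfs]; nlinarith
            have h7 : ‖w - s • c‖ ≤ s * L * (11 / 8) := by linarith
            have h8 := pow_le_pow_left₀ (norm_nonneg _) h7 2
            have h9 : 0 < (s * L) ^ 2 := by positivity
            nlinarith
          rw [div_lt_iff₀ hδ]
          have h4 : s * ⟪w, c⟫ * (2 * r) < s * ((η + 2 * s * (L ^ 2 / r)) * δ) * (2 * r) := by
            have h5 : s * ((η + 2 * s * (L ^ 2 / r)) * δ) * (2 * r)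
                = 2 * r * (δ + s ^ 2 * (L ^ 2 / r)) * δ := by rw [hfs]; ring
            have h6 : 2 * r * (δ + s ^ 2 * (L ^ 2 / r)) * δ
                = 2 * r * δ ^ 2 + δ * (2 * (s * L) ^ 2) := by field_simp
            rw [h5, h6]
            have := mul_lt_mul_of_pos_left h3 hδ
            nlinarith
          have h5 := lt_of_mul_lt_mul_right h4 (by positivity)
          exact lt_of_mul_lt_mul_left h5 hs0.le
    choose! g hg1 hg2 using hslope
    have := image_le_of_liminf_slope_right_lt_deriv_boundary (f := f) (f' := g) (a := 0) (b := 1)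
      (B := fun s => η * s + s ^ 2 * (L ^ 2 / r)) (B' := fun s => η + 2 * s * (L ^ 2 / r))
      hfcont.continuousOn hg1 (by simp [hf, infDist_zero_of_mem hx])
      (fun s => by
        have h1 := ((hasDerivAt_id s).const_mul η).add
          (((hasDerivAt_id s).pow 2).mul_const (L ^ 2 / r))
        exact h1.congr_deriv (by simp))
      hg2 (x := 1) (by simp)
    simpa using this
  have htend : Tendsto (fun η : ℝ => η + L ^ 2 / r) (𝓝[>] 0) (𝓝 (0 + L ^ 2 / r)) :=
    (Continuous.tendsto (by fun_prop) (0 : ℝ)).mono_left nhdsWithin_le_nhds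
  rw [zero_add] at htend
  have h1 : f 1 ≤ L ^ 2 / r := by
    refine ge_of_tendsto htend ?_
    filter_upwards [Ioc_mem_nhdsGT (by positivity : (0 : ℝ) < L / 8)] with η hη
      using main η hη.1 hη.2
  simpa [hf] using h1

end Proper

end Tangent

section Hulls

open Metric Filter Topology Set RealInnerProductSpace

/-! ### Convex hulls of points of `M` -/

variable {E : Type*} [NormedAddCommGroup E] [InnerProductSpace ℝ E]

lemma exists_mem_inner_sub_nonneg {σ : Set E} {y : E} (hy : y ∈ convexHull ℝ σ) (v : E) :
    ∃ a ∈ σ, 0 ≤ ⟪a - y, v⟫ := by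
  obtain ⟨a, ha, h⟩ := ((innerSL ℝ v).toLinearMap.convexOn convex_univ).exists_ge_of_mem_convexHull
    (subset_univ σ) hy
  refine ⟨a, ha, ?_⟩
  rw [real_inner_comm, inner_sub_right]
  simpa using h

/-- Let `σ ⊆ M` lie in a ball of radius `t < r`, and let `x` be a nearest point in `M` of a point
`y` of the convex hull of `σ`. Some point of `σ` is within `t` of `y`. As the ball of radius `r` that
touches `M` at `x` on the side of `y` contains no point of `σ`, the distance from `y` to `x` is at
most `t ^ 2 / r`. -/
lemma UniqueNearest.exists_dist_le_of_mem_convexHull [FiniteDimensional ℝ E] {M : Set E}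
    (hM : IsCompact M) {r : ℝ} (hr : UniqueNearest M r) {σ : Set E} (hσ : σ ⊆ M) {z : E} {t : ℝ}
    (ht : ∀ a ∈ σ, dist a z ≤ t) (htr : t < r) {x y : E} (hy : y ∈ convexHull ℝ σ) (hx : x ∈ M)
    (hxy : dist y x = infDist y M) : ∃ a ∈ σ, dist x a ≤ t * (1 + t / r) := by
  have hsq : ∀ a ∈ σ, ‖a - y‖ ^ 2 ≤ t ^ 2 - 2 * ⟪a - y, y - z⟫ := by
    intro a ha
    have h1 := pow_le_pow_left₀ dist_nonneg (ht a ha) 2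
    rw [dist_eq_norm, ← sub_add_sub_cancel a y z, norm_add_sq_real] at h1
    nlinarith [sq_nonneg ‖y - z‖]
  obtain ⟨a, ha, hav⟩ := exists_mem_inner_sub_nonneg hy (y - z)
  have ht0 : 0 ≤ t := dist_nonneg.trans (ht a ha)
  have hr0 : 0 < r := ht0.trans_lt htr
  have hya : dist y a ≤ t := by
    rw [dist_comm, dist_eq_norm]
    exact (abs_le_of_sq_le_sq' (by linarith [hsq a ha]) ht0).2
  have hδt : dist y x ≤ t := by
    rw [hxy]; exact (infDist_le_dist_of_mem (hσ ha)).trans hya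
  have hyx : dist y x * r ≤ t ^ 2 := by
    have hw : ‖y - x‖ = dist y x := (dist_eq_norm _ _).symm
    set δ := dist y x with hδ
    rcases (dist_nonneg (x := y) (y := x)).eq_or_lt with h0 | hpos
    · rw [hδ, ← h0, zero_mul]; positivity
    obtain ⟨b, hb, hbv⟩ := exists_mem_inner_sub_nonneg hy
      ((2 * r) • (y - x) + (2 * δ) • (y - z) - (2 * δ) • (y - x))
    have h1 := hr.inner_le hM hx hxy (by rw [← hxy]; linarith) (hσ hb)
    have h2 := hsq b hb
    rw [← sub_add_sub_cancel b y x, inner_add_left, real_inner_self_eq_norm_sq,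
      norm_add_sq_real, hw] at h1
    rw [inner_sub_right, inner_add_right, inner_smul_right, inner_smul_right,
      inner_smul_right] at hbv
    have h3 := mul_le_mul_of_nonneg_left h2 hpos.le
    have h4 : δ * (2 * r * δ) ≤ δ * (t ^ 2 + δ ^ 2) := by nlinarith
    have h5 := le_of_mul_le_mul_left h4 hpos
    nlinarith
  refine ⟨a, ha, (dist_triangle_left x a y).trans ?_⟩
  have h6 : dist y x ≤ t ^ 2 / r := by rwa [le_div_iff₀ hr0]
  calc dist y x + dist y a ≤ t ^ 2 / r + t := add_le_add h6 hya
    _ = t * (1 + t / r) := by ring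

/-- If every point `c` with `‖c‖ ≤ ρ` is at distance less than `ρ` from one of finitely many points
`p a`, then `0` is in the convex hull of some of these that lie in a common open ball of radius
`ρ`. They are the vertices of a Delaunay cell around `0`: the centre of the ball is a maximum of the
concave function `c ↦ min_a (‖p a‖ ^ 2 - 2 * ⟪p a, c⟫)`, and the points are those that attain the
minimum there. -/
lemma exists_ball_zero_mem_convexHull [FiniteDimensional ℝ E] {ι : Type*} (S : Finset ι)
    (p : ι → E) {ρ : ℝ} (hρ : 0 < ρ) (hcov : ∀ c : E, ‖c‖ ≤ ρ → ∃ a ∈ S, ‖p a - c‖ < ρ) :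
    ∃ c : E, ∃ σ ⊆ (S : Set ι), (∀ a ∈ σ, ‖p a - c‖ < ρ) ∧
      (0 : E) ∈ convexHull ℝ (p '' σ) := by
  have hS : S.Nonempty := by
    obtain ⟨a, ha, -⟩ := hcov 0 (by simpa using hρ.le)
    exact ⟨a, ha⟩
  set G : ι → E → ℝ := fun a c => ‖p a‖ ^ 2 - 2 * ⟪p a, c⟫ with hG
  have hGc : ∀ a, Continuous (G a) := fun a => by simp only [hG]; fun_prop
  have hGsq : ∀ a c, ‖p a - c‖ ^ 2 = G a c + ‖c‖ ^ 2 := fun a c => by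
    simp only [hG, norm_sub_sq_real]
  set F : E → ℝ := fun c => S.inf' hS fun a => G a c with hF
  have hFc : Continuous F := Continuous.finset_inf'_apply hS fun a _ => hGc a
  obtain ⟨c, hc, hmax⟩ := (isCompact_closedBall (0 : E) ρ).exists_isMaxOn
    ⟨0, mem_closedBall_self hρ.le⟩ hFc.continuousOn
  have hcρ : ‖c‖ ≤ ρ := by simpa using hc
  have hFlt : F c + ‖c‖ ^ 2 < ρ ^ 2 := by
    obtain ⟨a, ha, hlt⟩ := hcov c hcρ
    have h1 : F c ≤ G a c := Finset.inf'_le _ ha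
    have h2 := pow_lt_pow_left₀ hlt (norm_nonneg _) two_ne_zero
    rw [hGsq] at h2
    linarith
  have hF0 : 0 ≤ F c := by
    refine le_trans ?_ (hmax (mem_closedBall_self hρ.le) : F 0 ≤ F c)
    refine Finset.le_inf' _ _ fun a _ => ?_
    simp [hG]
  have hclt : ‖c‖ < ρ := lt_of_pow_lt_pow_left₀ 2 hρ.le (by linarith)
  set σ : Set ι := {a | a ∈ S ∧ G a c = F c} with hσ
  refine ⟨c, σ, fun a ha => ha.1, fun a ha => ?_, ?_⟩
  · refine lt_of_pow_lt_pow_left₀ 2 hρ.le ?_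
    rw [hGsq, ha.2]
    exact hFlt
  by_contra h0
  have hfin : (p '' σ).Finite := (S.finite_toSet.subset fun a ha => ha.1).image p
  -- a functional that separates `0` from the hull gives a direction in which the minimum increases
  obtain ⟨f, u, hf0, hfu⟩ := geometric_hahn_banach_point_closed (convex_convexHull ℝ (p '' σ))
    (hfin.isCompact_convexHull ℝ).isClosed h0
  set v : E := (InnerProductSpace.toDual ℝ E).symm f with hv
  have hvp : ∀ a ∈ σ, 0 < ⟪p a, v⟫ := by
    intro a ha
    have h1 := hfu (p a) (subset_convexHull ℝ _ (mem_image_of_mem p ha))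
    rw [map_zero] at hf0
    rw [real_inner_comm, hv, InnerProductSpace.toDual_symm_apply]
    linarith
  have hcont : Continuous fun h : ℝ => c - h • v := by fun_prop
  have hev : ∀ a ∈ S, ∀ᶠ h in 𝓝[>] (0 : ℝ), F c < G a (c - h • v) := by
    intro a ha
    by_cases haσ : a ∈ σ
    · filter_upwards [self_mem_nhdsWithin] with h hh
      have h1 : G a (c - h • v) = G a c + 2 * (h * ⟪p a, v⟫) := by
        simp only [hG, inner_sub_right, inner_smul_right]; ring
      have := mul_pos (show 0 < h from hh) (hvp a haσ)
      rw [h1, haσ.2]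
      linarith
    · have hlt : F c < G a c :=
        lt_of_le_of_ne (Finset.inf'_le _ ha) fun h => haσ ⟨ha, h.symm⟩
      refine nhdsWithin_le_nhds ((((hGc a).comp hcont).tendsto 0).eventually (lt_mem_nhds ?_))
      simpa using hlt
  have hball : ∀ᶠ h in 𝓝[>] (0 : ℝ), ‖c - h • v‖ < ρ :=
    nhdsWithin_le_nhds ((hcont.norm.tendsto 0).eventually (gt_mem_nhds (by simpa using hclt)))
  obtain ⟨h, h1, h2⟩ := (((Finset.eventually_all S).2 hev).and hball).exists
  have h3 : F (c - h • v) ≤ F c := hmax (by simpa using h2.le)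
  exact absurd h3 (not_le.2 ((Finset.lt_inf'_iff _).2 h1))

/-- Every point `x` of `M` is the nearest point of a convex combination of sample points that are
enclosed by a small ball: among the samples near `x`, projected to the tangent space at `x`, the
vertices of a Delaunay cell around `x` will do. -/
lemma IsTangentSpaceAt.exists_subset_convexHull [FiniteDimensional ℝ E] {M A : Set E}
    (hM : IsCompact M) {r : ℝ} (hr0 : 0 < r) (hr : UniqueNearest M r)
    (htan : ∀ m ∈ M, ∃ T, IsTangentSpaceAt M m T) (hA : A.Finite) (hAM : A ⊆ M) {ε : ℝ}
    (hε : 0 < ε) (hεr : ε < r / 8) (hcov : ∀ m ∈ M, ∃ a ∈ A, dist m a < ε) {x : E} (hx : x ∈ M)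
    {T : Submodule ℝ E} (hT : IsTangentSpaceAt M x T) :
    ∃ σ ⊆ A, (∃ z, ∀ a ∈ σ, dist a z ≤ ε * (1 + 6 * (ε / r))) ∧
      ∃ y ∈ convexHull ℝ σ, ∀ q ∈ M, q ≠ x → dist y x < dist y q := by
  -- the radius `ρ` solves `ε + ρ ^ 2 / r ≤ ρ`
  set k := ε / r with hk
  have hk0 : 0 < k := by positivity
  have hk8 : k < 1 / 8 := by rw [hk, div_lt_iff₀ hr0]; linarith
  set ρ := ε * (1 + 2 * k) with hρdef
  have hρ : 0 < ρ := by positivity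
  have hρr : ρ ≤ r * (5 / 32) := by rw [hρdef]; nlinarith
  have hρsq : ρ ^ 2 / r = ε * k * (1 + 2 * k) ^ 2 := by rw [hρdef, hk]; ring
  have hk2 : (1 + 2 * k) ^ 2 ≤ 25 / 16 := by nlinarith
  have hρ2 : ρ ^ 2 / r ≤ 25 / 16 * (ε * k) := by
    rw [hρsq]; nlinarith [mul_pos hε hk0]
  have hρε : ε + ρ ^ 2 / r ≤ ρ := by
    have : ρ = ε + 2 * (ε * k) := by rw [hρdef]; ring
    nlinarith [mul_pos hε hk0]
  have hSfin : (A ∩ closedBall x (2 * ρ)).Finite := hA.subset inter_subset_left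
  have hcovT : ∀ c : T, ‖c‖ ≤ ρ →
      ∃ a ∈ hSfin.toFinset, ‖T.orthogonalProjectionOnto (a - x) - c‖ < ρ := by
    intro c hc
    have hcn : ‖(c : E)‖ ≤ ρ := hc
    have h1 := hT.infDist_add_le hM hr0 hr htan hx c.2 (by linarith)
    have h2 : ‖(c : E)‖ ^ 2 / r ≤ ρ ^ 2 / r := by gcongr
    obtain ⟨m, hm, hdm⟩ := hM.exists_infDist_eq_dist ⟨x, hx⟩ (x + (c : E))
    obtain ⟨a, ha, hma⟩ := hcov m hm
    have h3 : ‖a - x - c‖ < ρ := by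
      have := dist_triangle (x + (c : E)) m a
      rw [dist_comm, dist_eq_norm, ← sub_sub] at this
      linarith
    have h4 : T.orthogonalProjectionOnto (a - x) - c = T.orthogonalProjectionOnto (a - x - c) := by
      rw [map_sub _ (a - x), Submodule.orthogonalProjectionOnto_mem_subspace_eq_self]
    refine ⟨a, ?_, ?_⟩
    · rw [Finite.mem_toFinset]
      refine ⟨ha, ?_⟩
      rw [mem_closedBall, dist_eq_norm]
      have := norm_add_le (a - x - c) (c : E)
      rw [sub_add_cancel] at this
      linarith
    · rw [h4]
      exact (T.norm_orthogonalProjectionOnto_apply_le _).trans_lt h3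
  obtain ⟨c, σ, hσS, hσc, h0⟩ := exists_ball_zero_mem_convexHull hSfin.toFinset
    (fun a => T.orthogonalProjectionOnto (a - x)) hρ hcovT
  rw [Finite.coe_toFinset] at hσS
  refine ⟨σ, fun a ha => (hσS ha).1, ⟨x + c, fun a ha => ?_⟩, ?_⟩
  · have hax : ‖a - x‖ ≤ 2 * ρ := by rw [← dist_eq_norm]; exact (hσS ha).2
    have h1 := hT.norm_sub_starProjection_le hM hr0 hr hx (hAM (hσS ha).1)
    set n := (a - x) - T.starProjection (a - x) with hn
    have h2 : ‖n‖ ≤ 2 * (ρ ^ 2 / r) := by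
      rw [← mul_div_assoc, le_div_iff₀ hr0]
      have := pow_le_pow_left₀ (norm_nonneg _) hax 2
      nlinarith
    have h3 : ‖T.starProjection (a - x) - c‖ < ρ := hσc a ha
    have h4 := norm_add_le n (T.starProjection (a - x) - c)
    rw [hn, sub_add_sub_cancel, ← hn, sub_sub, ← dist_eq_norm] at h4
    have h5 : ε * (1 + 6 * k) = ρ + 4 * (ε * k) := by rw [hρdef]; ring
    have := mul_pos hε hk0
    linarith
  · set g : E →ᵃ[ℝ] T := T.orthogonalProjectionOnto.toLinearMap.toAffineMap.comp
      (AffineMap.id ℝ E - AffineMap.const ℝ E x) with hg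
    have hga : ∀ a, g a = T.orthogonalProjectionOnto (a - x) := fun a => by simp [hg]
    have himage : (fun a => T.orthogonalProjectionOnto (a - x)) '' σ = g '' σ :=
      image_congr fun a _ => (hga a).symm
    rw [himage, ← AffineMap.image_convexHull] at h0
    obtain ⟨y, hy, hgy⟩ := h0
    rw [hga, Submodule.orthogonalProjectionOnto_eq_zero_iff] at hgy
    have hyball : y ∈ closedBall x (2 * ρ) :=
      convexHull_min (fun a ha => (hσS ha).2) (convex_closedBall x _) hy
    rw [mem_closedBall, dist_eq_norm] at hyball
    exact ⟨y, hy, fun q hq hqx => hT.dist_lt_of_ne hM hr hx hgy (by linarith) hq hqx⟩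

end Hulls

section Main

open Metric Filter Topology Set

/-! ### The reach and limits in `[0, ∞]` -/

lemma IsClosedC2Submanifold.exists_isTangentSpaceAt {D d : ℕ}
    {M : Set (EuclideanSpace ℝ (Fin D))} (hM : IsClosedC2Submanifold d M)
    {x : EuclideanSpace ℝ (Fin D)} (hx : x ∈ M) : ∃ T, IsTangentSpaceAt M x T := by
  obtain ⟨V, -, φ, hxs, hφ, hψ, hV⟩ := hM.straighten x hx
  exact _root_.exists_isTangentSpaceAt hx φ hxs hφ hψ hV

lemma uniqueNearest_of_lt_manifoldReach {D : ℕ} {M : Set (EuclideanSpace ℝ (Fin D))}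
    (hM : M.Nonempty) {r : ℝ} (hr : ENNReal.ofReal r < manifoldReach M) : UniqueNearest M r := by
  intro x hx z₁ h₁ z₂ h₂
  obtain ⟨r', hr', hlt⟩ := lt_sSup_iff.1 hr
  have hx' : infEDist x M < ENNReal.ofReal r :=
    (ENNReal.lt_ofReal_iff_toReal_lt (infEDist_ne_top hM)).2 hx
  obtain ⟨y, -, hy⟩ := hr' x (hx'.trans hlt)
  rw [hy z₁ h₁.1 h₁.2, hy z₂ h₂.1 h₂.2]

/-- A bound that holds for all numbers slightly above `e` and slightly below `τ` holds for `e` and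
`τ` themselves. -/
lemma le_mul_one_add_mul_div_of_eventually {X e τ k : ℝ≥0∞} (he : e ≠ ⊤) (hτ : τ ≠ 0)
    (hk : k ≠ ⊤)
    (h : ∀ᶠ p in 𝓝[>] e ×ˢ 𝓝[<] τ, X ≤ p.1 * (1 + k * (p.1 / p.2))) :
    X ≤ e * (1 + k * (e / τ)) := by
  have : (𝓝[>] e).NeBot := nhdsGT_neBot_of_exists_gt ⟨⊤, he.lt_top⟩
  have : (𝓝[<] τ).NeBot := nhdsLT_neBot_of_exists_lt ⟨0, pos_iff_ne_zero.2 hτ⟩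
  have h1 : Tendsto (fun p : ℝ≥0∞ × ℝ≥0∞ => p.1) (𝓝[>] e ×ˢ 𝓝[<] τ) (𝓝 e) :=
    tendsto_fst.mono_right nhdsWithin_le_nhds
  have h2 : Tendsto (fun p : ℝ≥0∞ × ℝ≥0∞ => p.2) (𝓝[>] e ×ˢ 𝓝[<] τ) (𝓝 τ) :=
    tendsto_snd.mono_right nhdsWithin_le_nhds
  have h3 : e / τ ≠ ⊤ := ENNReal.div_ne_top he hτ
  have h4 := ENNReal.Tendsto.const_mul (a := k) (ENNReal.Tendsto.div h1 (Or.inr hτ) h2 (Or.inr he))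
    (Or.inr hk)
  refine ge_of_tendsto (ENNReal.Tendsto.mul h1 (Or.inr ?_) (h4.const_add 1) (Or.inr he)) h
  exact ENNReal.add_ne_top.2 ⟨ENNReal.one_ne_top, ENNReal.mul_ne_top hk h3⟩

/-- The first inequality for a single admissible `t`. -/
lemma approximationRate_le_of_projectionImage_eq {D : ℕ} {M A : Set (EuclideanSpace ℝ (Fin D))}
    (hM : IsCompact M) (hAM : A ⊆ M) {t : ℝ≥0∞} (ht : t < manifoldReach M)
    (himage : projectionImage M (tConvexHull t A) = M) :
    approximationRate M A ≤ t * (1 + t / manifoldReach M) := by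
  refine hausdorffEDist_le_of_infEDist (fun x hx => ?_) fun x hx => ?_
  · rw [infEDist_zero_of_mem (hAM hx)]; exact zero_le
  rw [← himage] at hx
  obtain ⟨y, ⟨σ, hσA, hσt, hyσ⟩, ⟨hxM, hxy⟩, -⟩ := hx
  rw [← one_mul (t / manifoldReach M)]
  refine le_mul_one_add_mul_div_of_eventually ht.ne_top ht.ne_bot ENNReal.one_ne_top ?_
  obtain ⟨s, hts, hsτ⟩ := exists_between ht
  filter_upwards [prod_mem_prod (Ioo_mem_nhdsGT hts) (Ioo_mem_nhdsLT hsτ)]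
  rintro ⟨T, R⟩ ⟨⟨hT, hTs⟩, hsR, hRτ⟩
  simp only at hT hTs hsR hRτ ⊢
  lift T to NNReal using hTs.ne_top
  lift R to NNReal using hRτ.ne_top
  have hTR : T < R := by exact_mod_cast hTs.trans hsR
  have hR0 : R ≠ 0 := (zero_le.trans_lt hTR).ne'
  obtain ⟨z, hz⟩ := iInf_lt_iff.1 (hσt.trans_lt hT)
  have hz' : ∀ a ∈ σ, dist a z ≤ T := fun a ha => by
    have h1 : edist a z ≤ T := (le_iSup₂ (f := fun a (_ : a ∈ σ) => edist a z) a ha).trans hz.le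
    rw [edist_nndist] at h1
    exact_mod_cast h1
  have hr : UniqueNearest M R :=
    uniqueNearest_of_lt_manifoldReach ⟨x, hxM⟩ (by rwa [ENNReal.ofReal_coe_nnreal])
  obtain ⟨a, ha, hxa⟩ := hr.exists_dist_le_of_mem_convexHull hM (hσA.trans hAM) hz'
    (by exact_mod_cast hTR) hyσ hxM hxy
  refine (infEDist_le_edist_of_mem (hσA ha)).trans ?_
  rw [edist_nndist, one_mul, ← ENNReal.coe_div hR0]
  exact_mod_cast hxa

/-- The second inequality with `T` and `R` in place of `ε(A)` and `τ(M)`. -/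
lemma tStar_le_of_approximationRate_lt {D d : ℕ} {M A : Set (EuclideanSpace ℝ (Fin D))}
    (hM : IsClosedC2Submanifold d M) (hA : A.Finite) (hAM : A ⊆ M) {T R : ℝ≥0∞}
    (hT : approximationRate M A < T) (hTR : T < R / 8) (hR : R < manifoldReach M) :
    tStar M A ≤ T * (1 + 6 * (T / R)) := by
  lift T to NNReal using hTR.ne_top
  lift R to NNReal using hR.ne_top
  have hT0 : 0 < T := by exact_mod_cast zero_le.trans_lt hT
  have hTR' : T < R / 8 := by
    rw [show (8 : ℝ≥0∞) = ((8 : NNReal) : ℝ≥0∞) by norm_num,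
      ← ENNReal.coe_div (by norm_num)] at hTR
    exact_mod_cast hTR
  have hTRr : (T : ℝ) < R / 8 := by exact_mod_cast hTR'
  have hTr : (0 : ℝ) < T := by exact_mod_cast hT0
  have hRr : (0 : ℝ) < R := by linarith
  have hR0 : R ≠ 0 := by
    rintro rfl
    simp at hRr
  have hval : (T : ℝ≥0∞) * (1 + 6 * (T / R)) = ((T * (1 + 6 * (T / R)) : NNReal) : ℝ≥0∞) := by
    push_cast [ENNReal.coe_div hR0]
    rfl
  rw [hval]
  refine sInf_le ⟨lt_of_le_of_lt ?_ hR, Subset.antisymm ?_ fun x hx => ?_⟩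
  · rw [ENNReal.coe_le_coe, ← NNReal.coe_le_coe]
    push_cast
    have h1 : (T : ℝ) / R ≤ 1 / 8 := by rw [div_le_iff₀ hRr]; linarith
    nlinarith
  · rintro x ⟨y, -, h⟩
    exact h.1.1
  have hr : UniqueNearest M R :=
    uniqueNearest_of_lt_manifoldReach ⟨x, hx⟩ (by rwa [ENNReal.ofReal_coe_nnreal])
  have hcov : ∀ m ∈ M, ∃ a ∈ A, dist m a < T := by
    intro m hm
    have h1 : infEDist m A < T := by
      refine (infEDist_le_hausdorffEDist_of_mem hm).trans_lt ?_
      rwa [hausdorffEDist_comm]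
    obtain ⟨a, ha, hma⟩ := infEDist_lt_iff.1 h1
    rw [edist_nndist] at hma
    exact ⟨a, ha, by exact_mod_cast hma⟩
  obtain ⟨V, hV⟩ := hM.exists_isTangentSpaceAt hx
  obtain ⟨σ, hσA, ⟨z, hz⟩, y, hy, hlt⟩ := hV.exists_subset_convexHull hM.isCompact hRr hr
    (fun m hm => hM.exists_isTangentSpaceAt hm) hA hAM hTr hTRr hcov hx
  have hnear : dist y x = infDist y M := by
    refine le_antisymm ?_ (infDist_le_dist_of_mem hx)
    rw [le_infDist ⟨x, hx⟩]
    intro q hq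
    rcases eq_or_ne q x with rfl | hqx
    · exact le_rfl
    · exact (hlt q hq hqx).le
  refine ⟨y, ⟨σ, hσA, ?_, hy⟩, ⟨hx, hnear⟩, fun q hq hyq => ?_⟩
  · refine (iInf_le _ z).trans (iSup₂_le fun a ha => ?_)
    rw [edist_nndist]
    exact_mod_cast hz a ha
  · by_contra hqx
    have := hlt q hq hqx
    linarith

end Main

theorem proposition3p4 (D d : ℕ) (M : Set (EuclideanSpace ℝ (Fin D)))
    (hM : IsClosedC2Submanifold d M) (A : Set (EuclideanSpace ℝ (Fin D)))
    (hA : A.Finite) (hAM : A ⊆ M) :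
    approximationRate M A ≤ tStar M A * (1 + tStar M A / manifoldReach M) ∧
    (approximationRate M A < manifoldReach M / 8 →
      tStar M A ≤ approximationRate M A *
        (1 + 6 * (approximationRate M A / manifoldReach M))) := by
  constructor
  · rcases Set.eq_empty_or_nonempty
      {t | t < manifoldReach M ∧ projectionImage M (tConvexHull t A) = M} with hemp | hne
    · have htop : tStar M A = ⊤ := by rw [tStar, hemp, sInf_empty]
      rw [htop, ENNReal.top_mul (by simp)]
      exact le_top
    · obtain ⟨t₀, ht₀⟩ := hne
      have hτ0 : manifoldReach M ≠ 0 := ht₀.1.ne_bot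
      have hfin : tStar M A ≠ ⊤ := ((sInf_le ht₀).trans_lt ht₀.1).ne_top
      obtain ⟨u, -, hu, hmem⟩ := exists_seq_tendsto_sInf ⟨t₀, ht₀⟩ (OrderBot.bddBelow _)
      change Filter.Tendsto u Filter.atTop (nhds (tStar M A)) at hu
      refine ge_of_tendsto (ENNReal.Tendsto.mul hu (Or.inr ?_)
        ((ENNReal.Tendsto.div_const hu (Or.inr hτ0)).const_add 1) (Or.inr hfin))
        (Filter.Eventually.of_forall fun n =>
          approximationRate_le_of_projectionImage_eq hM.isCompact hAM (hmem n).1 (hmem n).2)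
      exact ENNReal.add_ne_top.2 ⟨ENNReal.one_ne_top, ENNReal.div_ne_top hfin hτ0⟩
  · intro hε
    have hτ0 : manifoldReach M ≠ 0 := by
      rintro h
      simp [h] at hε
    refine le_mul_one_add_mul_div_of_eventually hε.ne_top hτ0 (by simp) ?_
    obtain ⟨s, hεs, hsτ⟩ := exists_between hε
    have h8 : s * 8 < manifoldReach M :=
      (ENNReal.lt_div_iff_mul_lt (by simp) (by simp)).1 hsτ
    filter_upwards [Filter.prod_mem_prod (Ioo_mem_nhdsGT hεs) (Ioo_mem_nhdsLT h8)]
    rintro ⟨T, R⟩ ⟨⟨hT, hTs⟩, hsR, hRτ⟩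
    refine tStar_le_of_approximationRate_lt hM hA hAM hT (hTs.trans ?_) hRτ
    exact (ENNReal.lt_div_iff_mul_lt (by simp) (by simp)).2 hsR
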